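/- For $\rho\in[1,\infty]$ let $\rho^*\in[1,\infty]$ be its Hölder conjugate ($\tfrac1\rho+\tfrac1{\rho^*}=1$, $1/\infty=0$), let $B_\rho^n$ be the closed unit ball of $\ell_\rho^n$, write $\|Z\|_\rho=(\mathbb E|Z|^\rho)^{1/\rho}$ for a real random variable $Z$ and $1\le\rho<\infty$, $a\wedge b=\min\{a,b\}$, $a\vee b=\max\{a,b\}$, and $\operatorname{Log} n=\max\{1,\ln n\}$. For every $\alpha\ge 0$ there is a constant $C\in(0,\infty)$, depending only on $\alpha$, such that the following holds. Let $p,q\in[1,\infty)$ with $p^*\vee q\ge 2$, let $n\ge1$, and let $(X_{i,j})_{i,j\le n}$ be iid centered (integrable, mean zero) real random variables such that $\|X_{i,j}\|_{2\rho}\le\alpha\|X_{i,j}\|_\rho$ for all real $\rho\ge1$. Put \[ R:=n^{1/q}\sup_{t\in B_p^n}\Bigl\|\sum_{j=1}^n t_jX_{1,j}\Bigr\|_{q\wedge\operatorname{Log} n} +n^{1/p^*}\sup_{s\in B_{q^*}^n}\Bigl\|\sum_{i=1}^n s_iX_{i,1}\Bigr\|_{p^*\wedge\operatorname{Log} n}.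 \] Then \[ C^{-1}\,n^{1/(p^*\wedge q)}\,\|X_{1,1}\|_{p^*\wedge q\wedge\operatorname{Log} n} \;\le\; R\;\le\; C\,n^{1/(p^*\wedge q)}\,\|X_{1,1}\|_{p^*\wedge q\wedge\operatorname{Log} n}. \] -/

import Mathlib

open MeasureTheory ProbabilityTheory
open scoped ENNReal NNReal

noncomputable section

namespace RandomMatrix

/-- `Log n = max {1, ln n}`, as an extended nonnegative real (so that it can serve as an exponent). -/
def Log (n : ℕ) : ℝ≥0∞ := ENNReal.ofReal (max 1 (Real.log n))

/-- `B_p^n`, the closed unit ball of `ℓ_p^n`, for `p ∈ [1, ∞]`. -/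
def lpBall (p : ℝ≥0∞) (n : ℕ) : Set (Fin n → ℝ) := {t | ‖WithLp.toLp p t‖ ≤ 1}

/-- The real number `1 / p` for `p ∈ [1, ∞]`, with `1 / ∞ = 0`. -/
def recip (p : ℝ≥0∞) : ℝ := (p⁻¹).toReal

variable {Ω : Type*} [MeasurableSpace Ω]

/-- The `α`-regularity condition `‖Z‖_{2ρ} ≤ α ‖Z‖_ρ` for all real `ρ ≥ 1`. -/
def IsRegular (α : ℝ≥0) (Z : Ω → ℝ) (μ : Measure Ω) : Prop :=
  ∀ ρ : ℝ, 1 ≤ ρ →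
    eLpNorm Z (ENNReal.ofReal (2 * ρ)) μ ≤ (α : ℝ≥0∞) * eLpNorm Z (ENNReal.ofReal ρ) μ

/-- The entries of the random matrix `X` are iid and centered. -/
structure IsIIDCentered {m n : ℕ} (X : Fin m → Fin n → Ω → ℝ) (μ : Measure Ω) : Prop where
  indep : iIndepFun (fun k : Fin m × Fin n => X k.1 k.2) μ
  identDistrib : ∀ i j i' j', IdentDistrib (X i j) (X i' j') μ μ
  integrable : ∀ i j, Integrable (X i j) μ
  centered : ∀ i j, ∫ ω, X i j ω ∂μ = 0

/-- The quantity
`m^{1/q} sup_{t ∈ B_p^n} ‖∑_j t_j X_{1,j}‖_{q ∧ Log m}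
  + n^{1/p*} sup_{s ∈ B_{q*}^m} ‖∑_i s_i X_{i,1}‖_{p* ∧ Log n}`
of a random `m × n` matrix `X`; the index `1` is `0 : Fin _` here. -/
def twoTerm {m n : ℕ} [NeZero m] [NeZero n] (p q : ℝ≥0∞)
    (X : Fin m → Fin n → Ω → ℝ) (μ : Measure Ω) : ℝ≥0∞ :=
  (m : ℝ≥0∞) ^ recip q *
      (⨆ t ∈ lpBall p n, eLpNorm (fun ω => ∑ j, t j * X 0 j ω) (min q (Log m)) μ)
    + (n : ℝ≥0∞) ^ recip p.conjExponent *
      (⨆ s ∈ lpBall q.conjExponent m,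
        eLpNorm (fun ω => ∑ i, s i * X i 0 ω) (min p.conjExponent (Log n)) μ)

end RandomMatrix

end

namespace RandomMatrix

/-! Let `a` be the larger and `b` the smaller of p* and q, so that a ≥ 2; by transposition it does
not matter which is which. The summand of R with prefactor n^{1/b} already has the claimed size from
below: test it on a basis vector. The work is in the upper bounds.

For independent centered variables, the squared L^{2k} norm is subadditive up to a factor 5k on the
added summand (`eLpNorm_add_le_of_indepFun`), which gives a Khinchin bound with constant of order
√ρ. Cutting the coefficients at height 1/τ improves this to √(ρ/τ)‖Z‖_ρ on the ball dual to ℓ_τ, for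
2 ≤ τ ≤ ρ (`eLpNorm_sum_le_of_rpow_sum_le_one`). Taking τ = ρ loses nothing and settles the n^{1/b}
summand.

In the other summand the moment ρ = a ∧ Log n may exceed b. For large n and 2 ≤ b ≤ Log n,
regularity brings ρ down to b, at a total cost of order exp(ρ/b). The gap between n^{1/a} and
n^{1/b} pays for this up to a factor e (`rpow_mul_exp_le`). For b < 2 the exponent 2 replaces b in
this trade. -/

/-! ### Moments of sums of independent centered variables -/

theorem add_pow_sub_linear_term_le {A B : ℝ} (hA : 0 ≤ A) (hB : 0 ≤ B) {k : ℕ} (hk : 1 ≤ k) :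
    (A + B) ^ (2 * k) - 2 * k * A ^ (2 * k - 1) * B ≤ (A ^ 2 + 5 * k * B ^ 2) ^ k := by
  have hk1 : (1 : ℝ) ≤ k := by exact_mod_cast hk
  -- If A ≤ 2kB, the cross term 2AB is at most 4kB², so the linear term can be dropped. Otherwise x
  -- = B/A has 2kx ≤ 1, and the quadratic remainder 4k²x² of the exponential fits under Bernoulli's
  -- 5k²x².
  rcases le_or_gt A (2 * k * B) with h | h
  · have h1 : 0 ≤ 2 * k * A ^ (2 * k - 1) * B := by positivity
    have h2 : (A + B) ^ 2 ≤ A ^ 2 + 5 * k * B ^ 2 := by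
      nlinarith [mul_le_mul_of_nonneg_right h hB, mul_nonneg hB hB,
        mul_le_mul_of_nonneg_right hk1 (mul_nonneg hB hB)]
    calc (A + B) ^ (2 * k) - 2 * k * A ^ (2 * k - 1) * B ≤ (A + B) ^ (2 * k) := by linarith
      _ = ((A + B) ^ 2) ^ k := by rw [pow_mul]
      _ ≤ _ := pow_le_pow_left₀ (by positivity) h2 k
  · have hA0 : 0 < A := lt_of_le_of_lt (by positivity) h
    set x : ℝ := B / A with hx
    have hx0 : 0 ≤ x := by positivity
    have hBx : B = A * x := by rw [hx]; field_simp
    have hkx : 2 * k * x ≤ 1 := by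
      rw [hx, ← mul_div_assoc, div_le_one hA0]; exact h.le
    have e1 : (1 + x) ^ (2 * k) ≤ 1 + 2 * k * x + (2 * k * x) ^ 2 := by
      have h1 : (1 + x) ^ (2 * k) ≤ Real.exp (2 * k * x) := by
        calc (1 + x) ^ (2 * k) ≤ (Real.exp x) ^ (2 * k) :=
              pow_le_pow_left₀ (by positivity) (by linarith [Real.add_one_le_exp x]) _
          _ = Real.exp (2 * k * x) := by rw [← Real.exp_nat_mul]; push_cast; rfl
      have h2 := Real.abs_exp_sub_one_sub_id_le (x := 2 * k * x)
        (by rw [abs_of_nonneg (by positivity)]; exact hkx)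
      linarith [(abs_le.mp h2).2]
    have e2 : 1 + k * (5 * k * x ^ 2) ≤ (1 + 5 * k * x ^ 2) ^ k :=
      one_add_mul_le_pow (by have : 0 ≤ 5 * (k : ℝ) * x ^ 2 := by positivity
                             linarith) k
    have hpow : A ^ (2 * k) = A ^ (2 * k - 1) * A := by
      rw [← pow_succ]; congr 1; omega
    calc (A + B) ^ (2 * k) - 2 * k * A ^ (2 * k - 1) * B
        = A ^ (2 * k) * ((1 + x) ^ (2 * k) - 2 * k * x) := by
          rw [mul_sub, ← mul_pow, hpow, hBx]; ring
      _ ≤ A ^ (2 * k) * (1 + 5 * k * x ^ 2) ^ k := by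
          refine mul_le_mul_of_nonneg_left ?_ (by positivity)
          nlinarith [sq_nonneg ((k : ℝ) * x)]
      _ = (A ^ 2 + 5 * k * B ^ 2) ^ k := by
          rw [pow_mul, ← mul_pow, hBx]; ring

variable {Ω : Type*} [MeasurableSpace Ω] {μ : Measure Ω}

theorem ofReal_integral_abs_pow {Z : Ω → ℝ} {m : ℕ} (hm : m ≠ 0) (hZ : MemLp Z m μ) :
    ENNReal.ofReal (∫ ω, |Z ω| ^ m ∂μ) = eLpNorm Z m μ ^ m := by
  have h1 := eLpNorm_nnreal_pow_eq_lintegral (μ := μ) (f := Z) (p := (m : ℝ≥0))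
    (by exact_mod_cast hm)
  have h2 := hZ.integrable_norm_pow hm
  simp only [Real.norm_eq_abs] at h2
  rw [ofReal_integral_eq_lintegral_ofReal h2 (ae_of_all _ fun ω => by positivity)]
  simp only [ENNReal.coe_natCast, NNReal.coe_natCast, ENNReal.rpow_natCast] at h1
  rw [h1]
  refine lintegral_congr fun ω => ?_
  rw [ENNReal.ofReal_pow (abs_nonneg _), ← Real.enorm_eq_ofReal_abs]

theorem abs_integral_pow_le [IsProbabilityMeasure μ] {Z : Ω → ℝ} {N m : ℕ} (hmN : m ≤ N)
    (hZ : MemLp Z N μ) {A : ℝ} (hA : 0 ≤ A) (hZA : eLpNorm Z N μ ≤ ENNReal.ofReal A) :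
    |∫ ω, Z ω ^ m ∂μ| ≤ A ^ m := by
  rcases eq_or_ne m 0 with rfl | hm
  · simp
  have hmN' : (m : ℝ≥0∞) ≤ N := by exact_mod_cast hmN
  have h1 : |∫ ω, Z ω ^ m ∂μ| ≤ ∫ ω, |Z ω| ^ m ∂μ := by
    simpa [abs_pow] using abs_integral_le_integral_abs (μ := μ) (f := fun ω => Z ω ^ m)
  refine h1.trans ?_
  rw [← ENNReal.ofReal_le_ofReal_iff (by positivity),
    ofReal_integral_abs_pow hm (hZ.mono_exponent hmN'), ENNReal.ofReal_pow hA]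
  gcongr
  exact (eLpNorm_le_eLpNorm_of_exponent_le hmN' hZ.1).trans hZA

theorem integrable_pow_of_memLp [IsProbabilityMeasure μ] {Z : Ω → ℝ} {N m : ℕ} (hmN : m ≤ N)
    (hZ : MemLp Z N μ) : Integrable (fun ω => Z ω ^ m) μ := by
  have h := (hZ.mono_exponent (p := (m : ℝ≥0∞)) (by exact_mod_cast hmN)).integrable_norm_pow'
  refine h.mono' (hZ.1.pow m) (ae_of_all _ fun ω => ?_)
  simp

/-- The space `L^{2k}` is `2`-smooth with constant of order `k`, for independent summands. -/
theorem eLpNorm_add_le_of_indepFun [IsProbabilityMeasure μ] {Y Z : Ω → ℝ} {k : ℕ} (hk : 1 ≤ k)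
    (hY : MemLp Y (2 * k : ℕ) μ) (hZ : MemLp Z (2 * k : ℕ) μ) (hYZ : IndepFun Y Z μ)
    (hmean : ∫ ω, Z ω ∂μ = 0) {A B : ℝ} (hA : 0 ≤ A) (hB : 0 ≤ B)
    (hYA : eLpNorm Y (2 * k : ℕ) μ ≤ ENNReal.ofReal A)
    (hZB : eLpNorm Z (2 * k : ℕ) μ ≤ ENNReal.ofReal B) :
    eLpNorm (Y + Z) (2 * k : ℕ) μ ≤ ENNReal.ofReal (√(A ^ 2 + 5 * k * B ^ 2)) := by
  have hk0 : 2 * k ≠ 0 := by omega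
  have hprod : ∀ m ∈ Finset.range (2 * k + 1),
      Integrable (fun ω => Y ω ^ m * Z ω ^ (2 * k - m) * ((2 * k).choose m : ℝ)) μ ∧
      ∫ ω, Y ω ^ m * Z ω ^ (2 * k - m) * ((2 * k).choose m : ℝ) ∂μ =
        (∫ ω, Y ω ^ m ∂μ) * (∫ ω, Z ω ^ (2 * k - m) ∂μ) * ((2 * k).choose m : ℝ) := by
    intro m hm
    have hm' : m ≤ 2 * k := Nat.lt_succ_iff.mp (Finset.mem_range.mp hm)
    have hI1 := integrable_pow_of_memLp hm' hY
    have hI2 := integrable_pow_of_memLp (Nat.sub_le (2 * k) m) hZ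
    have hind : IndepFun (fun ω => Y ω ^ m) (fun ω => Z ω ^ (2 * k - m)) μ :=
      hYZ.comp (φ := fun x => x ^ m) (ψ := fun x => x ^ (2 * k - m))
        (measurable_id.pow_const _) (measurable_id.pow_const _)
    refine ⟨(hind.integrable_mul hI1 hI2).mul_const _, ?_⟩
    rw [integral_mul_const, hind.integral_fun_mul_eq_mul_integral hI1.1 hI2.1]
  have hint : ∫ ω, (Y ω + Z ω) ^ (2 * k) ∂μ ≤ (A ^ 2 + 5 * k * B ^ 2) ^ k := by
    refine le_trans ?_ (add_pow_sub_linear_term_le hA hB hk)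
    simp_rw [add_pow]
    rw [integral_finsetSum _ fun m hm => (hprod m hm).1,
      Finset.sum_congr rfl fun m hm => (hprod m hm).2]
    -- Only the binomial term linear in Z vanishes by centering; every other term is at most its
    -- counterpart in (A + B)^(2k).
    have hsum : ∑ m ∈ Finset.range (2 * k + 1),
        (if m = 2 * k - 1 then 2 * k * A ^ (2 * k - 1) * B else 0) =
          2 * k * A ^ (2 * k - 1) * B := by
      rw [Finset.sum_ite_eq', if_pos (Finset.mem_range.mpr (by omega))]
    rw [← hsum, ← Finset.sum_sub_distrib]
    refine Finset.sum_le_sum fun m hm => ?_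
    have hm' : m ≤ 2 * k := Nat.lt_succ_iff.mp (Finset.mem_range.mp hm)
    split_ifs with h
    · subst h
      have h1 : 2 * k - (2 * k - 1) = 1 := by omega
      have h2 : (2 * k).choose (2 * k - 1) = 2 * k := by
        have := Nat.choose_symm (n := 2 * k) (k := 1) (by omega)
        simpa using this
      rw [h1, h2]
      simp only [pow_one, hmean]
      push_cast
      linarith
    · rw [sub_zero]
      refine mul_le_mul_of_nonneg_right ?_ (by positivity)
      refine (le_abs_self _).trans ?_
      rw [abs_mul]
      exact mul_le_mul (abs_integral_pow_le hm' hY hA hYA)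
        (abs_integral_pow_le (Nat.sub_le _ _) hZ hB hZB) (abs_nonneg _) (by positivity)
  have hV : 0 ≤ A ^ 2 + 5 * k * B ^ 2 := by positivity
  rw [← ENNReal.pow_le_pow_left_iff hk0, ← ofReal_integral_abs_pow hk0 (hY.add hZ),
    ← ENNReal.ofReal_pow (Real.sqrt_nonneg _)]
  refine ENNReal.ofReal_le_ofReal ?_
  rw [pow_mul, Real.sq_sqrt hV]
  refine le_trans (le_of_eq ?_) hint
  refine integral_congr_ae (ae_of_all _ fun ω => ?_)
  simp [pow_mul]

/-- The coefficient of A² in the two-term bound is exactly 1, so induction on the summands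
accumulates no loss. -/
theorem eLpNorm_sum_le_of_iIndepFun [IsProbabilityMeasure μ] {ι : Type*} {Y : ι → Ω → ℝ} {k : ℕ}
    (hk : 1 ≤ k) (hY : ∀ i, MemLp (Y i) (2 * k : ℕ) μ) (hind : iIndepFun Y μ)
    (hmean : ∀ i, ∫ ω, Y i ω ∂μ = 0) {B : ι → ℝ} (hB : ∀ i, 0 ≤ B i)
    (hYB : ∀ i, eLpNorm (Y i) (2 * k : ℕ) μ ≤ ENNReal.ofReal (B i)) (s : Finset ι) :
    eLpNorm (∑ i ∈ s, Y i) (2 * k : ℕ) μ ≤ ENNReal.ofReal (√(5 * k * ∑ i ∈ s, B i ^ 2)) := by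
  classical
  induction s using Finset.induction_on with
  | empty => simp
  | insert i s hi ih =>
    have h := eLpNorm_add_le_of_indepFun hk (memLp_finsetSum' s fun j _ => hY j) (hY i)
      (hind.indepFun_finsetSum_of_notMem₀ (fun j => (hY j).1.aemeasurable) hi) (hmean i)
      (Real.sqrt_nonneg _) (hB i) ih (hYB i)
    rw [Real.sq_sqrt (by positivity)] at h
    rw [Finset.sum_insert hi, Finset.sum_insert hi, add_comm (Y i)]
    refine h.trans (le_of_eq ?_)
    congr 2
    ring

/-! ### Moment growth of regular variables -/

theorem IsRegular.eLpNorm_two_pow_mul_le {α : ℝ≥0} {Z : Ω → ℝ} (h : IsRegular α Z μ) {b : ℝ}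
    (hb : 1 ≤ b) (m : ℕ) :
    eLpNorm Z (ENNReal.ofReal (2 ^ m * b)) μ ≤ (α : ℝ≥0∞) ^ m * eLpNorm Z (ENNReal.ofReal b) μ := by
  induction m with
  | zero => simp
  | succ m ih =>
    have h1 : 1 ≤ 2 ^ m * b := one_le_mul_of_one_le_of_one_le (one_le_pow₀ (by norm_num)) hb
    have h2 := h _ h1
    rw [← mul_assoc, ← pow_succ'] at h2
    refine h2.trans ?_
    rw [pow_succ', mul_assoc]
    gcongr

/-- Doubling the exponent repeatedly gives growth of order (ρ/b)^d. The exponential form is the one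
absorbed by powers of n later; the factor 1/2 in the exponent leaves room for the Khinchin loss. -/
theorem IsRegular.eLpNorm_le_exp_mul [IsProbabilityMeasure μ] {α : ℝ≥0} {Z : Ω → ℝ}
    (h : IsRegular α Z μ) (hZ : AEStronglyMeasurable Z μ) {d : ℕ} (hd : α ≤ 2 ^ d) {b ρ : ℝ}
    (hb : 1 ≤ b) (hbρ : b ≤ ρ) :
    eLpNorm Z (ENNReal.ofReal ρ) μ ≤
      ENNReal.ofReal (4 ^ d * d.factorial * Real.exp (ρ / b / 2)) *
        eLpNorm Z (ENNReal.ofReal b) μ := by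
  have hb0 : 0 < b := by linarith
  have hx : 1 ≤ ρ / b := by rwa [one_le_div hb0]
  obtain ⟨m, hm1, hm2⟩ := exists_nat_pow_near hx (one_lt_two : (1 : ℝ) < 2)
  have hρ : ρ ≤ 2 ^ (m + 1) * b := by
    rw [div_lt_iff₀ hb0] at hm2; exact hm2.le
  refine (eLpNorm_le_eLpNorm_of_exponent_le (ENNReal.ofReal_le_ofReal hρ) hZ).trans
    ((h.eLpNorm_two_pow_mul_le hb (m + 1)).trans ?_)
  gcongr
  rw [← ENNReal.ofReal_coe_nnreal, ← ENNReal.ofReal_pow α.coe_nonneg]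
  refine ENNReal.ofReal_le_ofReal ?_
  have hd' : (α : ℝ) ≤ 2 ^ d := by exact_mod_cast hd
  have hexp := Real.pow_div_factorial_le_exp (ρ / b / 2) (by linarith) d
  rw [div_le_iff₀ (by positivity)] at hexp
  calc (α : ℝ) ^ (m + 1) ≤ (2 ^ d) ^ (m + 1) := pow_le_pow_left₀ α.2 hd' _
    _ = (2 * 2 ^ m) ^ d := by rw [← pow_mul, mul_comm, pow_mul, pow_succ']
    _ ≤ (2 * (ρ / b)) ^ d := by gcongr
    _ = 4 ^ d * (ρ / b / 2) ^ d := by rw [← mul_pow]; ring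
    _ ≤ 4 ^ d * (Real.exp (ρ / b / 2) * d.factorial) := by gcongr
    _ = _ := by ring

theorem IsRegular.memLp [IsProbabilityMeasure μ] {α : ℝ≥0} {Z : Ω → ℝ}
    (h : IsRegular α Z μ) (hZ : Integrable Z μ) (ρ : ℝ) : MemLp Z (ENNReal.ofReal ρ) μ := by
  obtain ⟨d, hd⟩ := pow_unbounded_of_one_lt α (one_lt_two : (1 : ℝ≥0) < 2)
  have h1 := h.eLpNorm_le_exp_mul hZ.1 hd.le le_rfl (le_max_left 1 ρ)
  have h2 : MemLp Z (ENNReal.ofReal (max 1 ρ)) μ := by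
    refine ⟨hZ.1, h1.trans_lt (ENNReal.mul_lt_top ENNReal.ofReal_lt_top ?_)⟩
    rw [ENNReal.ofReal_one]
    exact (memLp_one_iff_integrable.mpr hZ).2
  exact h2.mono_exponent (ENNReal.ofReal_le_ofReal (le_max_right 1 ρ))

/-! ### Weighted sums of independent copies -/

/-- The last hypothesis says that σ is at most the conjugate of ρ; the claim then follows from ρ ≤
2^(ρ-1). -/
theorem rpow_sub_one_le_two {ρ σ : ℝ} (hρ : 2 ≤ ρ) (hσ : 1 ≤ σ) (hσρ : (σ - 1) * (ρ - 1) ≤ 1) :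
    ρ ^ (σ - 1) ≤ 2 := by
  have h1 : ρ ≤ (2 : ℝ) ^ (ρ - 1) := by
    have := one_add_mul_self_le_rpow_one_add (s := 1) (by norm_num) (p := ρ - 1) (by linarith)
    norm_num at this
    linarith
  calc ρ ^ (σ - 1) ≤ ((2 : ℝ) ^ (ρ - 1)) ^ (σ - 1) :=
        Real.rpow_le_rpow (by linarith) h1 (by linarith)
    _ = (2 : ℝ) ^ ((ρ - 1) * (σ - 1)) := by rw [← Real.rpow_mul (by norm_num)]
    _ ≤ (2 : ℝ) ^ (1 : ℝ) := Real.rpow_le_rpow_of_exponent_le (by norm_num) (by linarith)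
    _ = 2 := Real.rpow_one 2

/-- Independent copies `Y i` of an `α`-regular centered random variable `Z`. -/
structure IsRegularCopies {ι : Type*} (α : ℝ≥0) (Z : Ω → ℝ) (Y : ι → Ω → ℝ) (μ : Measure Ω) :
    Prop where
  indep : iIndepFun Y μ
  identDistrib : ∀ i, IdentDistrib (Y i) Z μ μ
  integrable : Integrable Z μ
  centered : ∫ ω, Z ω ∂μ = 0
  regular : IsRegular α Z μ

namespace IsRegularCopies

variable {ι : Type*} {α : ℝ≥0} {Z : Ω → ℝ} {Y : ι → Ω → ℝ}

theorem aestronglyMeasurable_smul (h : IsRegularCopies α Z Y μ) (t : ι → ℝ) (i : ι) :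
    AEStronglyMeasurable (fun ω => t i * Y i ω) μ :=
  (h.identDistrib i).aemeasurable_fst.aestronglyMeasurable.const_mul _

theorem eLpNorm_smul (h : IsRegularCopies α Z Y μ) (t : ι → ℝ) (p : ℝ≥0∞) (i : ι) :
    eLpNorm (fun ω => t i * Y i ω) p μ = ENNReal.ofReal |t i| * eLpNorm Z p μ := by
  rw [← (h.identDistrib i).eLpNorm_eq p, ← Real.enorm_eq_ofReal_abs]
  exact eLpNorm_const_smul (t i) (Y i) p μ

variable [Fintype ι]

theorem aestronglyMeasurable_sum (h : IsRegularCopies α Z Y μ) (t : ι → ℝ) :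
    AEStronglyMeasurable (fun ω => ∑ i, t i * Y i ω) μ :=
  Finset.aestronglyMeasurable_fun_sum _ fun i _ => h.aestronglyMeasurable_smul t i

theorem eLpNorm_sum_le_sum_abs (h : IsRegularCopies α Z Y μ) (t : ι → ℝ) {p : ℝ≥0∞} (hp : 1 ≤ p) :
    eLpNorm (fun ω => ∑ i, t i * Y i ω) p μ ≤ ENNReal.ofReal (∑ i, |t i|) * eLpNorm Z p μ := by
  have h1 := eLpNorm_sum_le (s := Finset.univ) (f := fun i ω => t i * Y i ω) (μ := μ)
    (fun i _ => h.aestronglyMeasurable_smul t i) hp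
  have h2 : (∑ i, fun ω => t i * Y i ω) = fun ω => ∑ i, t i * Y i ω := by
    ext ω; simp
  rw [h2] at h1
  refine h1.trans (le_of_eq ?_)
  simp_rw [h.eLpNorm_smul]
  rw [← Finset.sum_mul, ENNReal.ofReal_sum_of_nonneg fun i _ => abs_nonneg _]

/-- A Khinchin-type bound for weighted sums of independent copies. -/
theorem eLpNorm_sum_le_sqrt [IsProbabilityMeasure μ] (h : IsRegularCopies α Z Y μ) (t : ι → ℝ)
    {ρ : ℝ} (hρ : 2 ≤ ρ) :
    eLpNorm (fun ω => ∑ i, t i * Y i ω) (ENNReal.ofReal ρ) μ ≤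
      ENNReal.ofReal (√(5 * ρ * ∑ i, t i ^ 2)) * (α * eLpNorm Z (ENNReal.ofReal ρ) μ) := by
  -- Round ρ up to an even integer 2k. Since 2k ≤ 2ρ, regularity returns to ρ at the cost of one
  -- factor α.
  set k : ℕ := ⌈ρ / 2⌉₊ with hk
  have hk1 : 1 ≤ k := Nat.one_le_ceil_iff.mpr (by linarith)
  have hk2 : ρ ≤ (2 * k : ℕ) := by
    have := Nat.le_ceil (ρ / 2)
    push_cast; linarith
  have hk3 : (k : ℝ) ≤ ρ := by
    have := Nat.ceil_lt_add_one (show 0 ≤ ρ / 2 by linarith)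
    linarith
  have hcast : ENNReal.ofReal ((2 * k : ℕ) : ℝ) = ((2 * k : ℕ) : ℝ≥0∞) := ENNReal.ofReal_natCast _
  have hZk : MemLp Z ((2 * k : ℕ) : ℝ≥0∞) μ := by
    rw [← hcast]; exact h.regular.memLp h.integrable _
  set N : ℝ := (eLpNorm Z ((2 * k : ℕ) : ℝ≥0∞) μ).toReal with hN
  have hN' : eLpNorm Z ((2 * k : ℕ) : ℝ≥0∞) μ = ENNReal.ofReal N :=
    (ENNReal.ofReal_toReal hZk.2.ne).symm
  have hind : iIndepFun (fun i ω => t i * Y i ω) μ :=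
    h.indep.comp (fun i x => t i * x) fun i => measurable_const_mul _
  have hmean : ∀ i, ∫ ω, t i * Y i ω ∂μ = 0 := fun i => by
    rw [integral_const_mul, (h.identDistrib i).integral_eq, h.centered, mul_zero]
  have key := eLpNorm_sum_le_of_iIndepFun hk1
    (fun i => ((h.identDistrib i).memLp_iff.mpr hZk).const_mul (t i)) hind hmean
    (B := fun i => |t i| * N) (fun i => by positivity)
    (fun i => by rw [h.eLpNorm_smul, hN', ENNReal.ofReal_mul (abs_nonneg _)]) Finset.univ
  have hfun : (∑ i, fun ω => t i * Y i ω) = fun ω => ∑ i, t i * Y i ω := by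
    ext ω; simp
  rw [hfun] at key
  calc eLpNorm (fun ω => ∑ i, t i * Y i ω) (ENNReal.ofReal ρ) μ
      ≤ eLpNorm (fun ω => ∑ i, t i * Y i ω) ((2 * k : ℕ) : ℝ≥0∞) μ := by
        rw [← hcast]
        exact eLpNorm_le_eLpNorm_of_exponent_le (ENNReal.ofReal_le_ofReal hk2)
          (h.aestronglyMeasurable_sum t)
    _ ≤ ENNReal.ofReal (√(5 * k * ∑ i, (|t i| * N) ^ 2)) := key
    _ = ENNReal.ofReal (√(5 * k * ∑ i, t i ^ 2)) * ENNReal.ofReal N := by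
        rw [← ENNReal.ofReal_mul (Real.sqrt_nonneg _)]
        congr 1
        simp_rw [mul_pow, sq_abs]
        rw [← Finset.sum_mul, ← mul_assoc, Real.sqrt_mul (by positivity),
          Real.sqrt_sq ENNReal.toReal_nonneg]
    _ ≤ _ := by
        gcongr
        rw [← hN']
        refine le_trans ?_ (h.regular ρ (by linarith))
        rw [← hcast]
        refine eLpNorm_le_eLpNorm_of_exponent_le (ENNReal.ofReal_le_ofReal ?_) h.integrable.1
        push_cast; linarith

/-- Coefficients above 1/τ have ℓ_1 norm at most 2, so the triangle inequality suffices. The others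
have squared ℓ_2 norm at most 2/τ, which cancels part of the √ρ in the Khinchin bound. Both
estimates use τ^(σ-1) ≤ 2. -/
theorem eLpNorm_sum_le_of_rpow_sum_le_one [IsProbabilityMeasure μ] (h : IsRegularCopies α Z Y μ)
    {t : ι → ℝ} {τ ρ σ : ℝ} (hτ : 2 ≤ τ) (hτρ : τ ≤ ρ) (hσ : 1 ≤ σ)
    (hστ : (σ - 1) * (τ - 1) ≤ 1)
    (ht : ∑ i, |t i| ^ σ ≤ 1) :
    eLpNorm (fun ω => ∑ i, t i * Y i ω) (ENNReal.ofReal ρ) μ ≤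
      (2 + 4 * α) * ENNReal.ofReal (√(ρ / τ)) * eLpNorm Z (ENNReal.ofReal ρ) μ := by
  classical
  have hτ0 : 0 < τ := by linarith
  have hpow := rpow_sub_one_le_two hτ hσ hστ
  have hσ2 : σ ≤ 2 := by nlinarith
  set u : ι → ℝ := fun i => if τ⁻¹ < |t i| then t i else 0 with hu
  set v : ι → ℝ := fun i => if τ⁻¹ < |t i| then 0 else t i with hv
  have hsplit : (fun ω => ∑ i, t i * Y i ω) =
      (fun ω => ∑ i, u i * Y i ω) + fun ω => ∑ i, v i * Y i ω := by
    ext ω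
    rw [Pi.add_apply, ← Finset.sum_add_distrib]
    refine Finset.sum_congr rfl fun i _ => ?_
    simp only [hu, hv]
    split_ifs <;> ring
  have hU : ∑ i, |u i| ≤ 2 := by
    calc ∑ i, |u i| ≤ ∑ i, 2 * |t i| ^ σ := by
          refine Finset.sum_le_sum fun i _ => ?_
          simp only [hu]
          split_ifs with hi
          · have hti : 0 < |t i| := lt_trans (by positivity) hi
            have h1 : 1 ≤ τ * |t i| := by
              rw [inv_lt_iff_one_lt_mul₀ hτ0] at hi; linarith
            have h2 : 1 ≤ τ ^ (σ - 1) * |t i| ^ (σ - 1) := by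
              rw [← Real.mul_rpow hτ0.le hti.le]
              exact Real.one_le_rpow h1 (by linarith)
            have h3 : |t i| ^ σ = |t i| ^ (σ - 1) * |t i| := by
              rw [← Real.rpow_add_one hti.ne']; congr 1; ring
            rw [h3]
            have h4 : 0 ≤ |t i| ^ (σ - 1) := by positivity
            nlinarith [mul_le_mul_of_nonneg_right hpow h4]
          · simp only [abs_zero]; positivity
      _ = 2 * ∑ i, |t i| ^ σ := by rw [Finset.mul_sum]
      _ ≤ 2 := by linarith
  have hV : ∑ i, v i ^ 2 ≤ 2 / τ := by
    calc ∑ i, v i ^ 2 ≤ ∑ i, 2 / τ * |t i| ^ σ := by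
          refine Finset.sum_le_sum fun i _ => ?_
          simp only [hv]
          split_ifs with hi
          · rw [zero_pow two_ne_zero]; positivity
          · rcases (abs_nonneg (t i)).eq_or_lt with h0 | hti
            · rw [← sq_abs, ← h0, zero_pow two_ne_zero]; positivity
            · have h1 : |t i| ^ (2 - σ) ≤ 2 / τ := by
                calc |t i| ^ (2 - σ) ≤ (τ⁻¹) ^ (2 - σ) :=
                      Real.rpow_le_rpow hti.le (not_lt.mp hi) (by linarith)
                  _ = τ ^ (σ - 1) / τ := by
                      rw [Real.inv_rpow hτ0.le, ← Real.rpow_neg hτ0.le,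
                        ← Real.rpow_sub_one hτ0.ne']
                      congr 1; ring
                  _ ≤ 2 / τ := by gcongr
              have h2 : t i ^ 2 = |t i| ^ (2 - σ) * |t i| ^ σ := by
                rw [← Real.rpow_add hti, ← sq_abs]; norm_num
              rw [h2]
              gcongr
      _ = 2 / τ * ∑ i, |t i| ^ σ := by rw [Finset.mul_sum]
      _ ≤ 2 / τ * 1 := by gcongr
      _ = 2 / τ := mul_one _
  have hρ1 : 1 ≤ ENNReal.ofReal ρ := by rw [ENNReal.one_le_ofReal]; linarith
  have hx : 1 ≤ √(ρ / τ) := by rw [Real.one_le_sqrt, one_le_div hτ0]; exact hτρ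
  rw [hsplit, add_mul, add_mul]
  refine (eLpNorm_add_le (h.aestronglyMeasurable_sum u) (h.aestronglyMeasurable_sum v) hρ1).trans
    (add_le_add ?_ ?_)
  · refine (h.eLpNorm_sum_le_sum_abs u hρ1).trans ?_
    gcongr
    calc ENNReal.ofReal (∑ i, |u i|) ≤ ENNReal.ofReal (2 * √(ρ / τ)) :=
          ENNReal.ofReal_le_ofReal (by linarith)
      _ = 2 * ENNReal.ofReal (√(ρ / τ)) := by
          rw [ENNReal.ofReal_mul (by norm_num), ENNReal.ofReal_ofNat]
  · refine (h.eLpNorm_sum_le_sqrt v (hτ.trans hτρ)).trans ?_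
    have hs : √(5 * ρ * ∑ i, v i ^ 2) ≤ 4 * √(ρ / τ) := by
      rw [Real.sqrt_le_left (by positivity), mul_pow,
        Real.sq_sqrt (div_nonneg (by linarith) hτ0.le)]
      calc 5 * ρ * ∑ i, v i ^ 2 ≤ 5 * ρ * (2 / τ) :=
            mul_le_mul_of_nonneg_left hV (by linarith)
        _ = 10 * (ρ / τ) := by ring
        _ ≤ 4 ^ 2 * (ρ / τ) := by
            have : 0 ≤ ρ / τ := div_nonneg (by linarith) hτ0.le
            linarith
    calc ENNReal.ofReal (√(5 * ρ * ∑ i, v i ^ 2)) * (α * eLpNorm Z (ENNReal.ofReal ρ) μ)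
        ≤ ENNReal.ofReal (4 * √(ρ / τ)) * (α * eLpNorm Z (ENNReal.ofReal ρ) μ) := by gcongr
      _ = _ := by
          rw [ENNReal.ofReal_mul (by norm_num), ENNReal.ofReal_ofNat]; ring

end IsRegularCopies

/-! ### Balls, conjugate exponents and the logarithm -/

theorem abs_le_one_of_mem_lpBall {p : ℝ≥0∞} (hp : 1 ≤ p) {n : ℕ} {t : Fin n → ℝ}
    (ht : t ∈ lpBall p n) (j : Fin n) : |t j| ≤ 1 := by
  have : Fact (1 ≤ p) := ⟨hp⟩
  exact (PiLp.norm_apply_le (WithLp.toLp p t) j).trans ht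

theorem sum_rpow_le_one_of_mem_lpBall {p : ℝ≥0∞} (hp : 1 ≤ p) (hp' : p ≠ ∞) {n : ℕ}
    {t : Fin n → ℝ} (ht : t ∈ lpBall p n) : ∑ j, |t j| ^ p.toReal ≤ 1 := by
  have hp0 : 0 < p.toReal := ENNReal.toReal_pos (by positivity) hp'
  have h : ‖WithLp.toLp p t‖ ≤ 1 := ht
  rw [PiLp.norm_eq_sum hp0] at h
  by_contra! hc
  exact absurd h (not_le.mpr (Real.one_lt_rpow hc (by positivity)))

theorem recip_le_recip {a b : ℝ≥0∞} (hb : 1 ≤ b) (hab : b ≤ a) : recip a ≤ recip b :=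
  ENNReal.toReal_mono (ENNReal.inv_ne_top.mpr (by positivity)) (ENNReal.inv_le_inv.mpr hab)

theorem recip_ofReal {r : ℝ} (hr : 0 < r) : recip (ENNReal.ofReal r) = r⁻¹ := by
  rw [recip, ENNReal.toReal_inv, ENNReal.toReal_ofReal hr.le]

theorem recip_add_recip (a a' : ℝ≥0∞) [h : a.HolderConjugate a'] : recip a + recip a' = 1 := by
  have h1 := ENNReal.HolderConjugate.inv_add_inv_eq_one a a'
  have ha : a⁻¹ ≠ ∞ := fun h => by simp [h] at h1
  have ha' : a'⁻¹ ≠ ∞ := fun h => by simp [h] at h1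
  rw [recip, recip, ← ENNReal.toReal_add ha ha', h1, ENNReal.toReal_one]

theorem one_le_of_holderConjugate (a a' : ℝ≥0∞) [h : a.HolderConjugate a'] : 1 ≤ a' := by
  have : a'.HolderConjugate a := h.symm
  exact ENNReal.HolderConjugate.one_le a' a

theorem Log_eq (n : ℕ) (hn : 2 ≤ Real.log n) : Log n = ENNReal.ofReal (Real.log n) := by
  rw [Log, max_eq_right (by linarith)]

theorem one_le_Log (n : ℕ) : 1 ≤ Log n := by
  rw [Log, ENNReal.one_le_ofReal]; exact le_max_left _ _

theorem Log_ne_top (n : ℕ) : Log n ≠ ∞ := ENNReal.ofReal_ne_top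

/-- The cutoff is 8 because 7 < e² < 8. -/
theorem two_le_log_of_eight_le {n : ℕ} (hn : 8 ≤ n) : 2 ≤ Real.log n := by
  rw [Real.le_log_iff_exp_le (by positivity)]
  have h1 : Real.exp 2 = Real.exp 1 * Real.exp 1 := by rw [← Real.exp_add]; norm_num
  have h2 : (8 : ℝ) ≤ n := by exact_mod_cast hn
  have := Real.exp_one_lt_d9
  have := Real.exp_pos 1
  nlinarith

theorem Log_le_two_of_lt_eight {n : ℕ} (hn : n < 8) : Log n ≤ 2 := by
  have h : Log n ≤ ENNReal.ofReal 2 := by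
    refine ENNReal.ofReal_le_ofReal (max_le (by norm_num) ?_)
    rcases Nat.eq_zero_or_pos n with rfl | hn0
    · simp
    rw [Real.log_le_iff_le_exp (by positivity)]
    have h1 : Real.exp 2 = Real.exp 1 * Real.exp 1 := by rw [← Real.exp_add]; norm_num
    have h2 : (n : ℝ) ≤ 7 := by exact_mod_cast Nat.lt_succ_iff.mp hn
    have := Real.exp_one_gt_d9
    nlinarith
  simpa using h

/-- Here u = 1/a and ρ = a ∧ log n. If ρ = log n, the exponential is n^{1/c} and n^u ≤ e. If ρu = 1,
then (log n)(1/c - u) ≥ ρ(1/c - u) = ρ/c - 1. -/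
theorem rpow_mul_exp_le {n : ℕ} (hn : 0 < n) {ρ u c : ℝ} (hρL : ρ ≤ Real.log n)
    (hu : ρ * u ≤ 1) (hρ : ρ = Real.log n ∨ ρ * u = 1) (huc : u ≤ c⁻¹) :
    (n : ℝ) ^ u * Real.exp (ρ / c) ≤ Real.exp 1 * (n : ℝ) ^ c⁻¹ := by
  have hn' : (0 : ℝ) < n := by exact_mod_cast hn
  rw [Real.rpow_def_of_pos hn', Real.rpow_def_of_pos hn', ← Real.exp_add, ← Real.exp_add,
    Real.exp_le_exp, div_eq_mul_inv]
  rcases hρ with h | h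
  · rw [← h]; linarith
  · nlinarith [mul_le_mul_of_nonneg_left huc (sub_nonneg.mpr hρL)]

/-- Power means: b' ≥ 2, and passing from ℓ_{b'} to ℓ_2 costs n^{1/2 - 1/b'} = n^{1/b - 1/2}. -/
theorem sum_sq_le_rpow_of_mem_lpBall {b b' : ℝ≥0∞} [b.HolderConjugate b']
    {n : ℕ} [NeZero n] (hb : b ≤ 2) {s : Fin n → ℝ} (hs : s ∈ lpBall b' n) :
    ∑ i, s i ^ 2 ≤ (n : ℝ) ^ (2 * recip b - 1) := by
  have hn : (0 : ℝ) < n := by exact_mod_cast NeZero.pos n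
  have hb'1 : 1 ≤ b' := one_le_of_holderConjugate b b'
  have hrec := recip_add_recip b b'
  by_cases hb' : b' = ∞
  · have h1 : recip b = 1 := by rw [hb'] at hrec; simpa [recip] using hrec
    calc ∑ i, s i ^ 2 ≤ ∑ _i : Fin n, (1 : ℝ) := by
          refine Finset.sum_le_sum fun i _ => ?_
          rw [sq_le_one_iff_abs_le_one]
          exact abs_le_one_of_mem_lpBall hb'1 hs i
      _ = (n : ℝ) ^ (2 * recip b - 1) := by rw [h1]; norm_num
  · have hσ0 : 0 < b'.toReal := ENNReal.toReal_pos (by positivity) hb'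
    have hrb' : recip b' = (b'.toReal)⁻¹ := ENNReal.toReal_inv _
    have h2 : (2 : ℝ)⁻¹ ≤ recip b := by
      have := recip_le_recip (ENNReal.HolderConjugate.one_le b b') hb
      simpa [recip] using this
    have hσ2 : 2 ≤ b'.toReal := by
      have : (b'.toReal)⁻¹ ≤ 2⁻¹ := by rw [← hrb']; linarith
      exact (inv_le_inv₀ hσ0 (by norm_num)).mp this
    have hsum := sum_rpow_le_one_of_mem_lpBall hb'1 hb' hs
    have key := Real.rpow_sum_le_const_mul_sum_rpow Finset.univ (fun i => s i ^ 2)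
      (p := b'.toReal / 2) (by linarith)
    have h3 : ∀ i, |s i ^ 2| ^ (b'.toReal / 2) = |s i| ^ b'.toReal := fun i => by
      rw [abs_pow, ← Real.rpow_natCast, ← Real.rpow_mul (abs_nonneg _)]
      congr 1; push_cast; ring
    simp_rw [h3] at key
    simp only [abs_pow, sq_abs, Finset.card_univ, Fintype.card_fin] at key
    have h4 : (∑ i, s i ^ 2) ^ (b'.toReal / 2) ≤ (n : ℝ) ^ (b'.toReal / 2 - 1) :=
      key.trans (mul_le_of_le_one_right (by positivity) hsum)
    have h5 : (n : ℝ) ^ (b'.toReal / 2 - 1) =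
        ((n : ℝ) ^ (2 * recip b - 1)) ^ (b'.toReal / 2) := by
      rw [← Real.rpow_mul hn.le]
      congr 1
      have : recip b = 1 - (b'.toReal)⁻¹ := by rw [← hrb']; linarith
      rw [this]; field_simp; ring
    rw [h5] at h4
    exact (Real.rpow_le_rpow_iff (Finset.sum_nonneg fun i _ => sq_nonneg _) (by positivity)
      (by positivity)).mp h4

/-! ### The summand with prefactor n^{1/b} -/

namespace IsRegularCopies

variable [IsProbabilityMeasure μ] {α : ℝ≥0} {Z : Ω → ℝ} {n : ℕ} {Y : Fin n → Ω → ℝ}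

theorem eLpNorm_sum_le_of_mem_lpBall (h : IsRegularCopies α Z Y μ) {a a' : ℝ≥0∞}
    [a.HolderConjugate a'] {t : Fin n → ℝ} (ht : t ∈ lpBall a' n) {τ ρ : ℝ} (hτ : 2 ≤ τ)
    (hτρ : τ ≤ ρ) (hτa : ENNReal.ofReal τ ≤ a) :
    eLpNorm (fun ω => ∑ i, t i * Y i ω) (ENNReal.ofReal ρ) μ ≤
      (2 + 4 * α) * ENNReal.ofReal (√(ρ / τ)) * eLpNorm Z (ENNReal.ofReal ρ) μ := by
  have ha'1 : 1 ≤ a' := one_le_of_holderConjugate a a'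
  have hrec := recip_add_recip a a'
  have hra : recip a ≤ τ⁻¹ := by
    rw [← recip_ofReal (by linarith)]
    exact recip_le_recip (by rw [ENNReal.one_le_ofReal]; linarith) hτa
  have hτ' : τ⁻¹ ≤ 2⁻¹ := inv_anti₀ (by norm_num) hτ
  have ha' : a' ≠ ∞ := by
    rintro rfl
    have : recip ∞ = 0 := by simp [recip]
    rw [this] at hrec; norm_num at hτ'; linarith
  have hra' : recip a' = (a'.toReal)⁻¹ := ENNReal.toReal_inv _
  have hσ : 1 ≤ a'.toReal := by simpa using ENNReal.toReal_mono ha' ha'1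
  refine h.eLpNorm_sum_le_of_rpow_sum_le_one hτ hτρ hσ ?_
    (sum_rpow_le_one_of_mem_lpBall ha'1 ha' ht)
  have h1 : 1 ≤ τ⁻¹ + (a'.toReal)⁻¹ := by linarith
  have h2 : τ * a'.toReal ≤ τ + a'.toReal := by
    have h3 := mul_le_mul_of_nonneg_left h1 (show 0 ≤ τ * a'.toReal by positivity)
    have h4 : τ * a'.toReal * (τ⁻¹ + (a'.toReal)⁻¹) = τ + a'.toReal := by
      field_simp; ring
    linarith
  linarith

theorem eLpNorm_sum_le_min (h : IsRegularCopies α Z Y μ) {a a' b l : ℝ≥0∞}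
    [a.HolderConjugate a'] (ha : 2 ≤ a) (hb : 1 ≤ b) (hba : b ≤ a) (hl : 1 ≤ l) (hl' : l ≠ ∞)
    {t : Fin n → ℝ} (ht : t ∈ lpBall a' n) :
    eLpNorm (fun ω => ∑ i, t i * Y i ω) (min b l) μ ≤
      (2 + 4 * α) * α * eLpNorm Z (min b l) μ := by
  set e := min b l with he
  have he1 : 1 ≤ e := le_min hb hl
  have hetop : e ≠ ∞ := ne_top_of_le_ne_top hl' (min_le_right _ _)
  have her : e = ENNReal.ofReal e.toReal := (ENNReal.ofReal_toReal hetop).symm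
  have hr1 : 1 ≤ e.toReal := by simpa using ENNReal.toReal_mono hetop he1
  set r := e.toReal with hr
  rw [her]
  -- Raising the exponent to r ∨ 2 ≤ a permits τ = ρ, hence no loss; as r ∨ 2 ≤ 2r, regularity then
  -- returns to r.
  have hρa : ENNReal.ofReal (max r 2) ≤ a := by
    rw [ENNReal.ofReal_max]
    refine max_le ?_ (by simpa using ha)
    rw [← her]; exact (min_le_left _ _).trans hba
  have h1 := h.eLpNorm_sum_le_of_mem_lpBall ht (le_max_right r 2) le_rfl hρa
  rw [div_self (by positivity), Real.sqrt_one, ENNReal.ofReal_one, mul_one] at h1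
  refine (eLpNorm_le_eLpNorm_of_exponent_le (ENNReal.ofReal_le_ofReal (le_max_left r 2))
    (h.aestronglyMeasurable_sum t)).trans (h1.trans ?_)
  rw [mul_assoc (2 + 4 * (α : ℝ≥0∞))]
  gcongr
  refine (eLpNorm_le_eLpNorm_of_exponent_le (ENNReal.ofReal_le_ofReal ?_)
    h.integrable.1).trans (h.regular r hr1)
  exact max_le (by linarith) (by linarith)

end IsRegularCopies

theorem natCast_rpow_eq_ofReal {n : ℕ} (hn : 0 < n) (u : ℝ) :
    (n : ℝ≥0∞) ^ u = ENNReal.ofReal ((n : ℝ) ^ u) := by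
  rw [← ENNReal.ofReal_natCast, ENNReal.ofReal_rpow_of_pos (by exact_mod_cast hn)]

theorem natCast_rpow_recip_le {n : ℕ} (hn : 0 < n) {a b : ℝ≥0∞} (hb : 1 ≤ b) (hba : b ≤ a) :
    (n : ℝ≥0∞) ^ recip a ≤ (n : ℝ≥0∞) ^ recip b :=
  ENNReal.rpow_le_rpow_of_exponent_le (by exact_mod_cast hn) (recip_le_recip hb hba)

theorem min_Log_eq_ofReal {n : ℕ} (hn : 8 ≤ n) {a : ℝ≥0∞} (ha : 2 ≤ a) :
    ∃ ρ : ℝ, 2 ≤ ρ ∧ min a (Log n) = ENNReal.ofReal ρ ∧ ρ ≤ Real.log n ∧ ρ * recip a ≤ 1 ∧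
      (ρ = Real.log n ∨ ρ * recip a = 1) := by
  have hL := two_le_log_of_eight_le hn
  rw [Log_eq n hL]
  rcases le_total a (ENNReal.ofReal (Real.log n)) with h | h
  · have hatop : a ≠ ∞ := ne_top_of_le_ne_top ENNReal.ofReal_ne_top h
    have ha2 : 2 ≤ a.toReal := by simpa using ENNReal.toReal_mono hatop ha
    have h1 : a.toReal * recip a = 1 := by
      rw [recip, ENNReal.toReal_inv, mul_inv_cancel₀ (by positivity)]
    refine ⟨a.toReal, ha2, ?_, ENNReal.toReal_le_of_le_ofReal (by linarith) h, h1.le, .inr h1⟩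
    rw [min_eq_left h, ENNReal.ofReal_toReal hatop]
  · refine ⟨Real.log n, hL, min_eq_right h, le_rfl, ?_, .inl rfl⟩
    have h1 := recip_le_recip (by rw [ENNReal.one_le_ofReal]; linarith) h
    rw [recip_ofReal (by linarith)] at h1
    calc Real.log n * recip a ≤ Real.log n * (Real.log n)⁻¹ :=
          mul_le_mul_of_nonneg_left h1 (by linarith)
      _ = 1 := mul_inv_cancel₀ (by positivity)

theorem sqrt_le_exp_half (x : ℝ) : √x ≤ Real.exp (x / 2) := by
  rw [Real.sqrt_le_left (Real.exp_pos _).le, ← Real.exp_nat_mul]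
  have h : ((2 : ℕ) : ℝ) * (x / 2) = x := by push_cast; ring
  rw [h]
  linarith [Real.add_one_le_exp x]

/-! ### The summand with prefactor n^{1/a}, by ranges of n and b -/

namespace IsRegularCopies

variable [IsProbabilityMeasure μ] {α : ℝ≥0} {Z : Ω → ℝ} {n : ℕ} [NeZero n] {Y : Fin n → Ω → ℝ} {a b b' : ℝ≥0∞}
  [b.HolderConjugate b'] {s : Fin n → ℝ}

/-- There are at most 7 coefficients, each at most 1 in absolute value, and every moment involved
lies between 1 and 2. -/
theorem rpow_mul_eLpNorm_sum_le_of_lt_eight (h : IsRegularCopies α Z Y μ) (hn : n < 8)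
    (hb : 1 ≤ b) (hba : b ≤ a) (hs : s ∈ lpBall b' n) :
    (n : ℝ≥0∞) ^ recip a * eLpNorm (fun ω => ∑ i, s i * Y i ω) (min a (Log n)) μ ≤
      7 * α * ((n : ℝ≥0∞) ^ recip b * eLpNorm Z (min b (Log n)) μ) := by
  have hsum : ∑ i, |s i| ≤ 7 := by
    calc ∑ i, |s i| ≤ ∑ _i : Fin n, (1 : ℝ) := Finset.sum_le_sum fun i _ =>
          abs_le_one_of_mem_lpBall (one_le_of_holderConjugate b b') hs i
      _ = n := by simp
      _ ≤ 7 := by exact_mod_cast Nat.lt_succ_iff.mp hn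
  have hZ : eLpNorm Z (min a (Log n)) μ ≤ α * eLpNorm Z (min b (Log n)) μ := by
    calc eLpNorm Z (min a (Log n)) μ ≤ eLpNorm Z (ENNReal.ofReal (2 * 1)) μ :=
          eLpNorm_le_eLpNorm_of_exponent_le
            ((min_le_right _ _).trans (by simpa using Log_le_two_of_lt_eight hn)) h.integrable.1
      _ ≤ α * eLpNorm Z (ENNReal.ofReal 1) μ := h.regular 1 le_rfl
      _ ≤ α * eLpNorm Z (min b (Log n)) μ := by
          gcongr
          refine eLpNorm_le_eLpNorm_of_exponent_le ?_ h.integrable.1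
          simpa using ⟨hb, one_le_Log n⟩
  calc (n : ℝ≥0∞) ^ recip a * eLpNorm (fun ω => ∑ i, s i * Y i ω) (min a (Log n)) μ
      ≤ (n : ℝ≥0∞) ^ recip b * (7 * (α * eLpNorm Z (min b (Log n)) μ)) := by
        refine mul_le_mul' (natCast_rpow_recip_le (NeZero.pos n) hb hba) ?_
        refine (h.eLpNorm_sum_le_sum_abs s (le_min (hb.trans hba) (one_le_Log n))).trans ?_
        gcongr
        simpa using ENNReal.ofReal_le_ofReal hsum
    _ = _ := by ring

/-- Both moments equal log n, so τ = ρ = log n applies without loss. -/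
theorem rpow_mul_eLpNorm_sum_le_of_Log_le (h : IsRegularCopies α Z Y μ) (hn : 8 ≤ n)
    (hLb : Log n ≤ b) (hba : b ≤ a) (hs : s ∈ lpBall b' n) :
    (n : ℝ≥0∞) ^ recip a * eLpNorm (fun ω => ∑ i, s i * Y i ω) (min a (Log n)) μ ≤
      (2 + 4 * α) * ((n : ℝ≥0∞) ^ recip b * eLpNorm Z (min b (Log n)) μ) := by
  have hL := two_le_log_of_eight_le hn
  rw [min_eq_right hLb, min_eq_right (hLb.trans hba)]
  rw [Log_eq n hL] at hLb ⊢
  have h1 := h.eLpNorm_sum_le_of_mem_lpBall hs hL le_rfl hLb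
  rw [div_self (by positivity), Real.sqrt_one, ENNReal.ofReal_one, mul_one] at h1
  have hb : 1 ≤ b := le_trans (by rw [ENNReal.one_le_ofReal]; linarith) hLb
  calc _ ≤ (n : ℝ≥0∞) ^ recip b *
        ((2 + 4 * α) * eLpNorm Z (ENNReal.ofReal (Real.log n)) μ) :=
        mul_le_mul' (natCast_rpow_recip_le (NeZero.pos n) hb hba) h1
    _ = _ := by ring

/-- With τ = b, the Khinchin loss √(ρ/b) contributes at most exp(ρ/(2b)), and moment growth from b
to ρ at most a multiple of the same. Their product is absorbed by `rpow_mul_exp_le`. -/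
theorem rpow_mul_eLpNorm_sum_le_of_two_le (h : IsRegularCopies α Z Y μ) {d : ℕ}
    (hd : α ≤ 2 ^ d) (hn : 8 ≤ n) (hbL : b ≤ Log n) (hb : 2 ≤ b) (hba : b ≤ a)
    (hs : s ∈ lpBall b' n) :
    (n : ℝ≥0∞) ^ recip a * eLpNorm (fun ω => ∑ i, s i * Y i ω) (min a (Log n)) μ ≤
      (2 + 4 * α) * ENNReal.ofReal (4 ^ d * d.factorial * Real.exp 1) *
        ((n : ℝ≥0∞) ^ recip b * eLpNorm Z (min b (Log n)) μ) := by
  have hn0 : 0 < n := NeZero.pos n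
  obtain ⟨ρ, hρ2, hρ, hρL, hρu, hρor⟩ := min_Log_eq_ofReal hn (hb.trans hba)
  have hbtop : b ≠ ∞ := ne_top_of_le_ne_top (Log_ne_top n) hbL
  obtain ⟨β, hβ2, rfl⟩ : ∃ β : ℝ, 2 ≤ β ∧ b = ENNReal.ofReal β :=
    ⟨b.toReal, by simpa using ENNReal.toReal_mono hbtop hb, (ENNReal.ofReal_toReal hbtop).symm⟩
  have hβρ : β ≤ ρ := by
    have : ENNReal.ofReal β ≤ ENNReal.ofReal ρ := by rw [← hρ]; exact le_min hba hbL
    exact (ENNReal.ofReal_le_ofReal_iff (by linarith)).mp this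
  have hra := recip_le_recip (by rw [ENNReal.one_le_ofReal]; linarith) hba
  rw [recip_ofReal (by linarith)] at hra
  rw [min_eq_left hbL, hρ, recip_ofReal (by linarith), natCast_rpow_eq_ofReal hn0,
    natCast_rpow_eq_ofReal hn0]
  have h1 := h.eLpNorm_sum_le_of_mem_lpBall hs hβ2 hβρ le_rfl
  have h2 := h.regular.eLpNorm_le_exp_mul h.integrable.1 hd (by linarith) hβρ
  have hreal : (n : ℝ) ^ recip a * √(ρ / β) *
      (4 ^ d * d.factorial * Real.exp (ρ / β / 2)) ≤
        4 ^ d * d.factorial * Real.exp 1 * (n : ℝ) ^ β⁻¹ := by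
    calc (n : ℝ) ^ recip a * √(ρ / β) * (4 ^ d * d.factorial * Real.exp (ρ / β / 2))
        ≤ (n : ℝ) ^ recip a * Real.exp (ρ / β / 2) *
          (4 ^ d * d.factorial * Real.exp (ρ / β / 2)) := by
          gcongr; exact sqrt_le_exp_half _
      _ = 4 ^ d * d.factorial * ((n : ℝ) ^ recip a * Real.exp (ρ / β)) := by
          have : Real.exp (ρ / β) = Real.exp (ρ / β / 2) * Real.exp (ρ / β / 2) := by
            rw [← Real.exp_add]; congr 1; ring
          rw [this]; ring
      _ ≤ 4 ^ d * d.factorial * (Real.exp 1 * (n : ℝ) ^ β⁻¹) := by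
          exact mul_le_mul_of_nonneg_left
            (rpow_mul_exp_le hn0 hρL hρu hρor hra) (by positivity)
      _ = _ := by ring
  set W := eLpNorm Z (ENNReal.ofReal β) μ
  calc _ ≤ ENNReal.ofReal ((n : ℝ) ^ recip a) * ((2 + 4 * α) * ENNReal.ofReal (√(ρ / β)) *
        (ENNReal.ofReal (4 ^ d * d.factorial * Real.exp (ρ / β / 2)) * W)) := by
        gcongr; exact h1.trans (by gcongr)
    _ = (2 + 4 * α) * (ENNReal.ofReal ((n : ℝ) ^ recip a * √(ρ / β) *
        (4 ^ d * d.factorial * Real.exp (ρ / β / 2))) * W) := by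
        rw [ENNReal.ofReal_mul (p := (n : ℝ) ^ recip a * √(ρ / β)) (by positivity),
          ENNReal.ofReal_mul (p := (n : ℝ) ^ recip a) (by positivity)]
        ring
    _ ≤ (2 + 4 * α) * (ENNReal.ofReal
        (4 ^ d * d.factorial * Real.exp 1 * (n : ℝ) ^ β⁻¹) * W) := by gcongr
    _ = _ := by rw [ENNReal.ofReal_mul (by positivity)]; simp only [mul_assoc]

/-- The comparison passes through exponent 2: the ball contributes n^{1/b - 1/2}, while √ρ and
moment growth from 2 to ρ are absorbed into n^{1/2}. -/
theorem rpow_mul_eLpNorm_sum_le_of_le_two (h : IsRegularCopies α Z Y μ) {d : ℕ}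
    (hd : α ≤ 2 ^ d) (hn : 8 ≤ n) (hbL : b ≤ Log n) (hb1 : 1 ≤ b) (hb : b ≤ 2) (ha : 2 ≤ a)
    (hs : s ∈ lpBall b' n) :
    (n : ℝ≥0∞) ^ recip a * eLpNorm (fun ω => ∑ i, s i * Y i ω) (min a (Log n)) μ ≤
      α ^ 2 * ENNReal.ofReal (6 * (4 ^ d * d.factorial) * Real.exp 1) *
        ((n : ℝ≥0∞) ^ recip b * eLpNorm Z (min b (Log n)) μ) := by
  have hn0 : 0 < n := NeZero.pos n
  have hnR : (0 : ℝ) < n := by exact_mod_cast hn0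
  obtain ⟨ρ, hρ2, hρ, hρL, hρu, hρor⟩ := min_Log_eq_ofReal hn ha
  have hra : recip a ≤ 2⁻¹ := by
    have := recip_le_recip (by norm_num) ha
    simpa [recip] using this
  have hsq := sum_sq_le_rpow_of_mem_lpBall hb hs
  rw [min_eq_left hbL, hρ, natCast_rpow_eq_ofReal hn0, natCast_rpow_eq_ofReal hn0]
  have h1 := h.eLpNorm_sum_le_sqrt s hρ2
  have h2 := h.regular.eLpNorm_le_exp_mul h.integrable.1 hd (by norm_num) hρ2
  have h3 : eLpNorm Z (ENNReal.ofReal 2) μ ≤ α * eLpNorm Z b μ := by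
    have h4 := h.regular 1 le_rfl
    rw [mul_one] at h4
    refine h4.trans ?_
    gcongr
    exact eLpNorm_le_eLpNorm_of_exponent_le (by simpa using hb1) h.integrable.1
  have hsqrt : √(5 * ρ * ∑ i, s i ^ 2) ≤
      6 * Real.exp (ρ / 2 / 2) * (n : ℝ) ^ (recip b - 2⁻¹) := by
    rw [Real.sqrt_le_left (by positivity)]
    have e1 : (n : ℝ) ^ (2 * recip b - 1) = ((n : ℝ) ^ (recip b - 2⁻¹)) ^ 2 := by
      rw [← Real.rpow_natCast, ← Real.rpow_mul hnR.le]; congr 1; push_cast; ring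
    have e2 : Real.exp (ρ / 2 / 2) ^ 2 = Real.exp (ρ / 2) := by
      rw [← Real.exp_nat_mul]; congr 1; push_cast; ring
    rw [e1] at hsq
    rw [mul_pow, mul_pow, e2]
    have e3 : 5 * ρ ≤ 6 ^ 2 * Real.exp (ρ / 2) := by
      linarith [Real.add_one_le_exp (ρ / 2), Real.exp_pos (ρ / 2)]
    exact mul_le_mul e3 hsq (Finset.sum_nonneg fun i _ => sq_nonneg _) (by positivity)
  have hreal : (n : ℝ) ^ recip a * (6 * Real.exp (ρ / 2 / 2) * (n : ℝ) ^ (recip b - 2⁻¹)) *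
      (4 ^ d * d.factorial * Real.exp (ρ / 2 / 2)) ≤
        6 * (4 ^ d * d.factorial) * Real.exp 1 * (n : ℝ) ^ recip b := by
    calc _ = 6 * (4 ^ d * d.factorial) * ((n : ℝ) ^ recip a * Real.exp (ρ / 2)) *
          (n : ℝ) ^ (recip b - 2⁻¹) := by
          have : Real.exp (ρ / 2) = Real.exp (ρ / 2 / 2) * Real.exp (ρ / 2 / 2) := by
            rw [← Real.exp_add]; congr 1; ring
          rw [this]; ring
      _ ≤ 6 * (4 ^ d * d.factorial) * (Real.exp 1 * (n : ℝ) ^ (2 : ℝ)⁻¹) *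
          (n : ℝ) ^ (recip b - 2⁻¹) := by
          refine mul_le_mul_of_nonneg_right (mul_le_mul_of_nonneg_left
            (rpow_mul_exp_le hn0 hρL hρu hρor hra) ?_) ?_ <;> positivity
      _ = 6 * (4 ^ d * d.factorial) * Real.exp 1 *
          ((n : ℝ) ^ (2 : ℝ)⁻¹ * (n : ℝ) ^ (recip b - 2⁻¹)) := by ring
      _ = _ := by rw [← Real.rpow_add hnR]; congr 2; ring
  set W := eLpNorm Z b μ
  calc _ ≤ ENNReal.ofReal ((n : ℝ) ^ recip a) *
        (ENNReal.ofReal (6 * Real.exp (ρ / 2 / 2) * (n : ℝ) ^ (recip b - 2⁻¹)) *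
          (α * (ENNReal.ofReal (4 ^ d * d.factorial * Real.exp (ρ / 2 / 2)) * (α * W)))) := by
        gcongr
        refine h1.trans ?_
        gcongr
        exact h2.trans (by gcongr)
    _ = α ^ 2 * (ENNReal.ofReal ((n : ℝ) ^ recip a *
        (6 * Real.exp (ρ / 2 / 2) * (n : ℝ) ^ (recip b - 2⁻¹)) *
          (4 ^ d * d.factorial * Real.exp (ρ / 2 / 2))) * W) := by
        rw [ENNReal.ofReal_mul (p := (n : ℝ) ^ recip a *
            (6 * Real.exp (ρ / 2 / 2) * (n : ℝ) ^ (recip b - 2⁻¹))) (by positivity),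
          ENNReal.ofReal_mul (p := (n : ℝ) ^ recip a) (by positivity)]
        ring
    _ ≤ α ^ 2 * (ENNReal.ofReal
        (6 * (4 ^ d * d.factorial) * Real.exp 1 * (n : ℝ) ^ recip b) * W) := by gcongr
    _ = _ := by rw [ENNReal.ofReal_mul (by positivity)]; simp only [mul_assoc]

/-- The constant in `RandomMatrix.IsRegularCopies.rpow_mul_eLpNorm_sum_le`. -/
noncomputable def rowConst (α : ℝ≥0) (d : ℕ) : ℝ≥0 :=
  7 * α + (2 + 4 * α) + (2 + 4 * α) * Real.toNNReal (4 ^ d * d.factorial * Real.exp 1) +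
    α ^ 2 * Real.toNNReal (6 * (4 ^ d * d.factorial) * Real.exp 1)

theorem rpow_mul_eLpNorm_sum_le (h : IsRegularCopies α Z Y μ) {d : ℕ}
    (hd : α ≤ 2 ^ d) (hb : 1 ≤ b) (ha : 2 ≤ a) (hba : b ≤ a) (hs : s ∈ lpBall b' n) :
    (n : ℝ≥0∞) ^ recip a * eLpNorm (fun ω => ∑ i, s i * Y i ω) (min a (Log n)) μ ≤
      rowConst α d * ((n : ℝ≥0∞) ^ recip b * eLpNorm Z (min b (Log n)) μ) := by
  have hc : (rowConst α d : ℝ≥0∞) = 7 * α + (2 + 4 * α) +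
      (2 + 4 * α) * ENNReal.ofReal (4 ^ d * d.factorial * Real.exp 1) +
        α ^ 2 * ENNReal.ofReal (6 * (4 ^ d * d.factorial) * Real.exp 1) := by
    simp only [rowConst, ENNReal.ofReal]; push_cast; rfl
  rw [hc]
  rcases lt_or_ge n 8 with hn | hn
  · refine (h.rpow_mul_eLpNorm_sum_le_of_lt_eight hn hb hba hs).trans ?_
    refine mul_le_mul_left ?_ _
    rw [add_assoc, add_assoc]
    exact le_self_add
  rcases le_total (Log n) b with hLb | hbL
  · refine (h.rpow_mul_eLpNorm_sum_le_of_Log_le hn hLb hba hs).trans ?_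
    refine mul_le_mul_left ?_ _
    exact le_add_self.trans (le_self_add.trans le_self_add)
  rcases le_total 2 b with hb2 | hb2
  · refine (h.rpow_mul_eLpNorm_sum_le_of_two_le hd hn hbL hb2 hba hs).trans ?_
    exact mul_le_mul_left (le_add_self.trans le_self_add) _
  · refine (h.rpow_mul_eLpNorm_sum_le_of_le_two hd hn hbL hb hb2 ha hs).trans ?_
    exact mul_le_mul_left le_add_self _

end IsRegularCopies

/-! ### Lower bound and assembly -/

theorem eLpNorm_le_iSup_lpBall {n : ℕ} [NeZero n]
    {p : ℝ≥0∞} (hp : 1 ≤ p) (Y : Fin n → Ω → ℝ) (e : ℝ≥0∞) :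
    eLpNorm (Y 0) e μ ≤ ⨆ t ∈ lpBall p n, eLpNorm (fun ω => ∑ j, t j * Y j ω) e μ := by
  classical
  have : Fact (1 ≤ p) := ⟨hp⟩
  have hmem : Pi.single (0 : Fin n) (1 : ℝ) ∈ lpBall p n := by
    have h := PiLp.norm_single p (fun _ : Fin n => ℝ) 0 1
    exact h.le.trans (by simp)
  refine le_trans (le_of_eq ?_) (le_iSup₂ (f := fun t (_ : t ∈ lpBall p n) =>
    eLpNorm (fun ω => ∑ j, t j * Y j ω) e μ) _ hmem)
  congr 1
  ext ω
  simp [Pi.single_apply]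

theorem IsIIDCentered.isRegularCopies_row {n : ℕ}
    [NeZero n] {X : Fin n → Fin n → Ω → ℝ} (h : IsIIDCentered X μ) {α : ℝ≥0}
    (hreg : IsRegular α (X 0 0) μ) : IsRegularCopies α (X 0 0) (fun j => X 0 j) μ where
  indep := h.indep.precomp (g := fun j : Fin n => ((0 : Fin n), j)) fun i j hij => by simpa using hij
  identDistrib j := h.identDistrib 0 j 0 0
  integrable := h.integrable 0 0
  centered := h.centered 0 0
  regular := hreg

theorem IsIIDCentered.isRegularCopies_col {n : ℕ}
    [NeZero n] {X : Fin n → Fin n → Ω → ℝ} (h : IsIIDCentered X μ) {α : ℝ≥0}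
    (hreg : IsRegular α (X 0 0) μ) : IsRegularCopies α (X 0 0) (fun i => X i 0) μ where
  indep := h.indep.precomp (g := fun i : Fin n => (i, (0 : Fin n))) fun i j hij => by simpa using hij
  identDistrib i := h.identDistrib i 0 0 0
  integrable := h.integrable 0 0
  centered := h.centered 0 0
  regular := hreg

/-- Both summands of `twoTerm`, for `b ≤ a` and `2 ≤ a`. -/
theorem IsRegularCopies.add_iSup_le
    [IsProbabilityMeasure μ] {α : ℝ≥0} {Z : Ω → ℝ} {n : ℕ} [NeZero n] {Y Y' : Fin n → Ω → ℝ}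
    (hY : IsRegularCopies α Z Y μ) (hY' : IsRegularCopies α Z Y' μ) {a a' b b' : ℝ≥0∞}
    [a.HolderConjugate a'] [b.HolderConjugate b'] {d : ℕ} (hd : α ≤ 2 ^ d) (ha : 2 ≤ a)
    (hb : 1 ≤ b) (hba : b ≤ a) :
    (n : ℝ≥0∞) ^ recip b *
        (⨆ t ∈ lpBall a' n, eLpNorm (fun ω => ∑ j, t j * Y j ω) (min b (Log n)) μ) +
      (n : ℝ≥0∞) ^ recip a *
        (⨆ s ∈ lpBall b' n, eLpNorm (fun ω => ∑ i, s i * Y' i ω) (min a (Log n)) μ) ≤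
      ((2 + 4 * α) * α + rowConst α d : ℝ≥0) *
        ((n : ℝ≥0∞) ^ recip b * eLpNorm Z (min b (Log n)) μ) := by
  push_cast
  rw [add_mul]
  refine add_le_add ?_ ?_
  · rw [mul_left_comm]
    gcongr
    exact iSup₂_le fun t ht => hY.eLpNorm_sum_le_min ha hb hba (one_le_Log n) (Log_ne_top n) ht
  · simp_rw [ENNReal.mul_iSup]
    exact iSup₂_le fun s hs => hY'.rpow_mul_eLpNorm_sum_le hd hb ha hba hs

end RandomMatrix

theorem mainTheorem3 (α : ℝ≥0) :
    ∃ C : ℝ≥0, 0 < C ∧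
      ∀ (p q : ℝ≥0∞), 1 ≤ p → p ≠ ∞ → 1 ≤ q → q ≠ ∞ → 2 ≤ max p.conjExponent q →
      ∀ (n : ℕ) [NeZero n] (Ω : Type*) [MeasurableSpace Ω] (μ : Measure Ω)
        [IsProbabilityMeasure μ] (X : Fin n → Fin n → Ω → ℝ),
        RandomMatrix.IsIIDCentered X μ →
        (∀ i j, RandomMatrix.IsRegular α (X i j) μ) →
        RandomMatrix.twoTerm p q X μ ≤
            (C : ℝ≥0∞) * ((n : ℝ≥0∞) ^ RandomMatrix.recip (min p.conjExponent q) *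
              eLpNorm (X 0 0) (min (min p.conjExponent q) (RandomMatrix.Log n)) μ) ∧
          (n : ℝ≥0∞) ^ RandomMatrix.recip (min p.conjExponent q) *
              eLpNorm (X 0 0) (min (min p.conjExponent q) (RandomMatrix.Log n)) μ ≤
            (C : ℝ≥0∞) * RandomMatrix.twoTerm p q X μ := by
  -- Choosing `d` from α alone, before p, q and n, keeps the constant uniform.
  obtain ⟨d, hd⟩ := pow_unbounded_of_one_lt α (one_lt_two : (1 : ℝ≥0) < 2)
  set C₀ : ℝ≥0 := (2 + 4 * α) * α + RandomMatrix.IsRegularCopies.rowConst α d with hC₀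
  have hC : (1 : ℝ≥0∞) ≤ ((1 + C₀ : ℝ≥0) : ℝ≥0∞) := by exact_mod_cast le_self_add
  have hC' : (C₀ : ℝ≥0∞) ≤ ((1 + C₀ : ℝ≥0) : ℝ≥0∞) := by exact_mod_cast le_add_self
  refine ⟨1 + C₀, by positivity, fun p q hp _ hq _ hpq n _ Ω _ μ _ X hX hreg => ?_⟩
  have hp' : p.HolderConjugate p.conjExponent := .conjExponent hp
  have hp'' : p.conjExponent.HolderConjugate p := hp'.symm
  have hq' : q.HolderConjugate q.conjExponent := .conjExponent hq
  have hrow := hX.isRegularCopies_row (hreg 0 0)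
  have hcol := hX.isRegularCopies_col (hreg 0 0)
  have hp1 : 1 ≤ p.conjExponent := RandomMatrix.one_le_of_holderConjugate p _
  have hq1 : 1 ≤ q.conjExponent := RandomMatrix.one_le_of_holderConjugate q _
  rw [RandomMatrix.twoTerm]
  -- The two cases are transposes of each other: rows and columns exchange roles, as do p* and q.
  rcases le_total q p.conjExponent with h | h
  · rw [min_eq_right h]
    rw [max_eq_left h] at hpq
    refine ⟨(hrow.add_iSup_le hcol hd.le hpq hq h).trans (mul_le_mul_left hC' _),
      le_trans ?_ (le_mul_of_one_le_left' hC)⟩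
    · refine le_trans ?_ le_self_add
      gcongr
      exact RandomMatrix.eLpNorm_le_iSup_lpBall hp (fun j => X 0 j) _
  · rw [min_eq_left h]
    rw [max_eq_right h] at hpq
    refine ⟨?_, le_trans ?_ (le_mul_of_one_le_left' hC)⟩
    · rw [add_comm]
      exact (hcol.add_iSup_le hrow hd.le hpq hp1 h).trans (mul_le_mul_left hC' _)
    · refine le_trans ?_ le_add_self
      gcongr
      exact RandomMatrix.eLpNorm_le_iSup_lpBall hq1 (fun i => X i 0) _
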